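/- Let $G$ be a finite group and $n=|G|$. Let $v(1)$ be a uniformly distributed random element of $G$, let $Z_1,Z_2,\dots$ be i.i.d. random elements of $G$ independent of $v(1)$, and let $v(t+1)=Z_t\,v(t)$ for $t\ge 1$. The random walk $v$ has step distribution $\gamma(s)=\mathbb P(Z_t=s)$, $s\in G$. A scenery on $G$ is a function $f:G\to\{0,1\}$. The walk $v$ is called reconstructive if, for all sceneries $f_1,f_2$ on $G$, the distributions of the sequences $\{f_1(v(t))\}_{t\ge1}$ and $\{f_2(v(t))\}_{t\ge1}$ are identical only if $f_1$ is a shift of $f_2$, i.e. there is a $g\in G$ with $f_1(k)=f_2(kg)$ for all $k\in G$. For an irreducible complex matrix representation $\rho$ of $G$ let $d_\rho$ be its degree and $\hat\gamma(\rho)=\sum_{s\in G}\gamma(s)\rho(s)$. For $J:G^n\to\mathbb R$ let $$\hat J(\rho_1\otimes\cdots\otimes\rho_n)=\sum_{x_1,\dots,x_n\in G}J(x_1,\dots,x_n)\,\rho_1(x_1)\otimes\cdots\otimes\rho_n(x_n).$$ Suppose that the following condition holds: every function $J:G^n\to\mathbb R$ such that $$\sum_{\rho_1,\dots,\rho_n}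 d_{\rho_1}\cdots d_{\rho_n}\,\mathrm{Tr}\Big(\big(\hat\gamma(\rho_1)^{\ell_1}\otimes\cdots\otimes\hat\gamma(\rho_n)^{\ell_n}\big)\,\hat J(\rho_1\otimes\cdots\otimes\rho_n)\Big)=0$$ for all positive integers $\ell_1,\dots,\ell_n$, where $\rho_1,\dots,\rho_n$ each range over all irreducible representations of $G$ up to equivalence, satisfies $J(x_1,\dots,x_n)=0$ for all $x_1,\dots,x_n\in G$. Then $v$ is reconstructive. -/

import Mathlib

open MeasureTheory ProbabilityTheory

noncomputable section

namespace SceneryReconstruction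

/-! ### Matrix representations and their equivalence classes -/

/-- The action on `ℂ^d` of a matrix representation `G → GL_d(ℂ)`. -/
def toRepresentation {G : Type*} [Group G] {d : ℕ} (ρ : G →* GL (Fin d) ℂ) :
    Representation ℂ G (Fin d → ℂ) :=
  ((Matrix.toLinAlgEquiv' : Matrix (Fin d) (Fin d) ℂ ≃ₐ[ℂ] _) :
      Matrix (Fin d) (Fin d) ℂ →* ((Fin d → ℂ) →ₗ[ℂ] (Fin d → ℂ))).comp
    ((Units.coeHom _).comp ρ)

/-- An irreducible complex matrix representation of `G`, of some positive degree. -/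
structure IrredMatrixRep (G : Type*) [Group G] where
  /-- The degree `d_ρ`. -/
  degree : ℕ
  /-- The homomorphism `G → GL_{d_ρ}(ℂ)`. -/
  hom : G →* GL (Fin degree) ℂ
  irreducible : (toRepresentation hom).IsIrreducible

/-- Equivalence of irreducible representations. -/
instance irredSetoid (G : Type*) [Group G] : Setoid (IrredMatrixRep G) where
  r ρ σ := Nonempty ((toRepresentation ρ.hom).Equiv (toRepresentation σ.hom))
  iseqv := ⟨fun _ => ⟨.refl _⟩, fun ⟨e⟩ => ⟨e.symm⟩, fun ⟨e⟩ ⟨e'⟩ => ⟨e.trans e'⟩⟩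

/-- The set of irreducible representations of `G` up to equivalence. -/
def Irrep (G : Type*) [Group G] : Type _ := Quotient (irredSetoid G)

namespace Irrep

variable {G : Type*} [Group G]

/-- A representative of an equivalence class of irreducible representations. -/
def rep (c : Irrep G) : IrredMatrixRep G := Quotient.out c

/-- The degree `d_ρ` of an irreducible representation. -/
def degree (c : Irrep G) : ℕ := c.rep.degree

/-- The matrices `ρ(s)` of (a representative of) an irreducible representation. -/
def mat (c : Irrep G) : G →* Matrix (Fin c.degree) (Fin c.degree) ℂ :=
  (Units.coeHom _).comp c.rep.hom

end Irrep

/-- A finite group has only finitely many irreducible representations up to equivalence. -/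
instance finite_irrep (G : Type*) [Group G] [Finite G] : Finite (Irrep G) := by
  classical
  have : Fintype G := Fintype.ofFinite G
  have hG : (Nat.card G : ℂ) ≠ 0 := by simp
  have : Invertible (Nat.card G : ℂ) := invertibleOfNonzero hG
  let R : ∀ c : Irrep G, Representation ℂ G (Fin c.degree → ℂ) :=
    fun c => toRepresentation c.rep.hom
  have hR : ∀ c, (R c).IsIrreducible := fun c => c.rep.irreducible
  have key : ∀ c c' : Irrep G, (Nat.card G : ℂ)⁻¹ *
      ∑ g : G, (R c).character g * (R c').character g⁻¹ = if c' = c then 1 else 0 := by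
    intro c c'
    have h1 := hR c
    have h2 := hR c'
    rw [Representation.char_orthonormal]
    have : Nonempty ((R c').Equiv (R c)) ↔ c' = c := by
      constructor
      · intro h
        exact Quotient.out_equiv_out.mp h
      · rintro rfl
        exact ⟨.refl _⟩
    simp only [this]
  have hli : LinearIndependent ℂ (fun c : Irrep G => (R c).character) := by
    rw [linearIndependent_iff']
    intro s a ha c' hc'
    have h2 : (Nat.card G : ℂ)⁻¹ *
        ∑ g : G, (∑ c ∈ s, a c • (R c).character) g * (R c').character g⁻¹ = 0 := by
      rw [ha]
      simp
    have h3 : (Nat.card G : ℂ)⁻¹ *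
        ∑ g : G, (∑ c ∈ s, a c • (R c).character) g * (R c').character g⁻¹
        = ∑ c ∈ s, a c * ((Nat.card G : ℂ)⁻¹ *
          ∑ g : G, (R c).character g * (R c').character g⁻¹) := by
      simp only [Finset.sum_apply, Pi.smul_apply, smul_eq_mul, Finset.sum_mul, Finset.mul_sum]
      rw [Finset.sum_comm]
      refine Finset.sum_congr rfl fun c _ => Finset.sum_congr rfl fun g _ => ?_
      ring
    rw [h3] at h2
    simp only [key] at h2
    simpa [hc'] using h2
  exact hli.finite

instance fintypeIrrep (G : Type*) [Group G] [Finite G] : Fintype (Irrep G) :=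
  Fintype.ofFinite _

/-! ### Tensor products of matrices and Fourier transforms -/

/-- The tensor (Kronecker) product `A_1 ⊗ ... ⊗ A_n` of square matrices. Its rows and columns are
indexed by the tuples of indices of the factors. -/
def tensorMatrix {n : ℕ} {d : Fin n → ℕ} (A : ∀ i, Matrix (Fin (d i)) (Fin (d i)) ℂ) :
    Matrix (∀ i, Fin (d i)) (∀ i, Fin (d i)) ℂ :=
  Matrix.of fun a b => ∏ i, A i (a i) (b i)

/-- The representation `ρ_1 ⊗ ... ⊗ ρ_n` of `G^n`, sending `(x_1, ..., x_n)` to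
`ρ_1(x_1) ⊗ ... ⊗ ρ_n(x_n)`. -/
def tensorRep {G : Type*} [Group G] {n : ℕ} (ρ : Fin n → Irrep G) :
    (Fin n → G) →* Matrix (∀ i, Fin (ρ i).degree) (∀ i, Fin (ρ i).degree) ℂ where
  toFun x := tensorMatrix fun i => (ρ i).mat (x i)
  map_one' := by
    classical
    ext a b
    simp only [tensorMatrix, Pi.one_apply, map_one, Matrix.of_apply, Matrix.one_apply]
    rw [Finset.prod_ite_zero]
    simp [funext_iff]
  map_mul' x y := by
    classical
    ext a b
    simp only [tensorMatrix, Pi.mul_apply, map_mul, Matrix.of_apply, Matrix.mul_apply]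
    rw [Finset.prod_univ_sum]
    simp [Finset.prod_mul_distrib]

/-- The Fourier transform `f̂(ρ) = ∑_s f(s) ρ(s)` of a function on a finite group. -/
def fourierTransform {H : Type*} [Group H] [Fintype H] {m : Type*} [Fintype m] [DecidableEq m]
    (f : H → ℝ) (ρ : H →* Matrix m m ℂ) : Matrix m m ℂ :=
  ∑ s, (f s : ℂ) • ρ s

/-- The sum
`∑ d_{ρ_1} ⋯ d_{ρ_n} Tr((γ̂(ρ_1)^{ℓ_1} ⊗ ⋯ ⊗ γ̂(ρ_n)^{ℓ_n}) Ĵ(ρ_1 ⊗ ⋯ ⊗ ρ_n))`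
over all `n`-tuples of irreducible representations of `G` up to equivalence. -/
def traceSum {G : Type*} [Group G] [Fintype G] {n : ℕ} (γ : G → ℝ) (ℓ : Fin n → ℕ)
    (J : (Fin n → G) → ℝ) : ℂ :=
  ∑ ρ : Fin n → Irrep G, (∏ i, ((ρ i).degree : ℂ)) *
    Matrix.trace (tensorMatrix (fun i => fourierTransform γ (ρ i).mat ^ ℓ i) * fourierTransform J (tensorRep ρ))

/-- The sufficient condition on a step distribution `γ`, with `n = |G|`: the only `J` on `G^n` for
which `traceSum γ ℓ J` vanishes for all positive `ℓ_1, ..., ℓ_n` is `J = 0`. -/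
def FourierCondition {G : Type*} [Group G] [Fintype G] (γ : G → ℝ) : Prop :=
  ∀ J : (Fin (Fintype.card G) → G) → ℝ,
    (∀ ℓ : Fin (Fintype.card G) → ℕ, (∀ i, 0 < ℓ i) → traceSum γ ℓ J = 0) → ∀ x, J x = 0

/-! ### Random walks and sceneries -/

section Walk

variable {G : Type*} [Group G] [MeasurableSpace G] {Ω : Type*} [MeasurableSpace Ω]

/-- `v` is a random walk on `G` with step distribution `γ`: `v (t + 1) = Z t * v t`, where the
increments `Z t` are i.i.d. with distribution `γ` and independent of the initial position `v 0`. -/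
def IsRandomWalk (μ : Measure Ω) (γ : G → ℝ) (v : ℕ → Ω → G) : Prop :=
  Measurable (v 0) ∧ ∃ Z : ℕ → Ω → G,
    (∀ t, Measurable (Z t)) ∧
    iIndepFun Z μ ∧
    IndepFun (v 0) (fun ω t => Z t ω) μ ∧
    (∀ t s, μ.real (Z t ⁻¹' {s}) = γ s) ∧
    ∀ t ω, v (t + 1) ω = Z t ω * v t ω

/-- The walk starts from the uniform distribution on `G`. -/
def UniformStart (μ : Measure Ω) (v : ℕ → Ω → G) : Prop :=
  ∀ g : G, μ.real (v 0 ⁻¹' {g}) = (Nat.card G : ℝ)⁻¹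

/-- The distribution of the sequence `f(v(t))`, for a scenery `f : G → {0, 1}`. -/
def observedLaw (μ : Measure Ω) (v : ℕ → Ω → G) (f : G → Fin 2) : Measure (ℕ → Fin 2) :=
  μ.map fun ω t => f (v t ω)

/-- `v` is reconstructive: two sceneries with the same observed distribution are shifts of each
other. -/
def Reconstructive (μ : Measure Ω) (v : ℕ → Ω → G) : Prop :=
  ∀ f₁ f₂ : G → Fin 2, observedLaw μ v f₁ = observedLaw μ v f₂ →
    ∃ g : G, ∀ k : G, f₁ k = f₂ (k * g)

end Walk

end SceneryReconstruction

end

namespace SceneryReconstruction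

section Completeness

universe u

open scoped MonoidAlgebra

variable {G : Type*} [Group G]

/-- A class function orthogonal to an irreducible character acts as zero. -/
theorem sum_smul_eq_zero_of_character [Fintype G] {V : Type*} [AddCommGroup V] [Module ℂ V]
    [FiniteDimensional ℂ V] (σ : Representation ℂ G V) [σ.IsIrreducible] (φ : G → ℂ)
    (hφ : ∀ g h, φ (h * g * h⁻¹) = φ g) (h0 : ∑ g, φ g * σ.character g = 0) :
    ∑ g, φ g • σ g = 0 := by
  let T : Representation.IntertwiningMap σ σ :=
    { toLinearMap := ∑ g, φ g • σ g
      isIntertwining' := by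
        intro h
        change (∑ g, φ g • σ g) * σ h = σ h * (∑ g, φ g • σ g)
        rw [Finset.sum_mul, Finset.mul_sum]
        rw [← (MulAut.conj h).toEquiv.sum_comp]
        refine Finset.sum_congr rfl fun g _ => ?_
        simp [hφ, ← map_mul] }
  obtain ⟨c, hc⟩ :=
    (Representation.IsIrreducible.algebraMap_intertwiningMap_bijective_of_isAlgClosed
      (ρ := σ)).surjective T
  have hT : ∑ g, φ g • σ g = c • (1 : V →ₗ[ℂ] V) := by
    change T.toLinearMap = _
    rw [← hc]
    rfl
  have htr : c * (Module.finrank ℂ V : ℂ) = 0 := by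
    have := congrArg (LinearMap.trace ℂ V) hT
    simp only [map_sum, map_smul, LinearMap.trace_one, smul_eq_mul] at this
    rw [← this]
    exact h0
  have : Nontrivial V := by
    have : IsSimpleModule ℂ[G] σ.asModule := inferInstance
    exact IsSimpleModule.nontrivial ℂ[G] σ.asModule
  have hd : (Module.finrank ℂ V : ℂ) ≠ 0 := by
    exact_mod_cast (Module.finrank_pos (R := ℂ) (M := V)).ne'
  rw [hT, (mul_eq_zero.mp htr).resolve_right hd, zero_smul]

/-- Every finite-dimensional irreducible representation is equivalent to one of the chosen
representatives. -/
theorem exists_irrep_equiv {V : Type*} [AddCommGroup V] [Module ℂ V]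
    [FiniteDimensional ℂ V] (σ : Representation ℂ G V) [hσ : σ.IsIrreducible] :
    ∃ c : Irrep G, Nonempty ((toRepresentation c.rep.hom).Equiv σ) := by
  let b := Module.finBasis ℂ V
  let ρ : G →* GL (Fin (Module.finrank ℂ V)) ℂ :=
    (((LinearMap.toMatrixAlgEquiv b : (V →ₗ[ℂ] V) ≃ₐ[ℂ] _) :
      (V →ₗ[ℂ] V) →* Matrix _ _ ℂ).comp σ).toHomUnits
  let e : (toRepresentation ρ).Equiv σ := .mk b.equivFun.symm (by
    intro g
    apply LinearMap.ext
    intro x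
    apply b.equivFun.injective
    simp only [LinearMap.comp_apply, LinearEquiv.coe_coe, LinearEquiv.apply_symm_apply]
    have := LinearMap.toMatrix_mulVec_repr b b (σ g) (b.equivFun.symm x)
    change (LinearMap.toMatrix b b (σ g)).mulVec x = _
    rw [← Module.Basis.equivFun_apply, LinearEquiv.apply_symm_apply] at this
    exact this)
  have hρ : (toRepresentation ρ).IsIrreducible := by
    rw [Representation.irreducible_iff_isSimpleModule_asModule] at hσ ⊢
    exact IsSimpleModule.congr (LinearEquiv.ofBijective
      (Representation.IntertwiningMap.equivLinearMapAsModule _ _ e.toIntertwiningMap)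
      e.toLinearEquiv.bijective)
  let R : IrredMatrixRep G := ⟨_, ρ, hρ⟩
  obtain ⟨e'⟩ : Nonempty ((toRepresentation (Irrep.rep ⟦R⟧).hom).Equiv (toRepresentation R.hom)) :=
    Quotient.mk_out (s := irredSetoid G) R
  exact ⟨⟦R⟧, ⟨e'.trans e⟩⟩

theorem asAlgebraHom_ofModule' (M : Type*) [AddCommGroup M] [Module ℂ M] [Module ℂ[G] M]
    [IsScalarTower ℂ ℂ[G] M] :
    (Representation.ofModule' (k := ℂ) (G := G) M).asAlgebraHom = Algebra.lsmul ℂ ℂ M :=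
  (MonoidAlgebra.lift ℂ (M →ₗ[ℂ] M) G).apply_symm_apply _

theorem isIrreducible_ofModule' (M : Type*) [AddCommGroup M] [Module ℂ M] [Module ℂ[G] M]
    [IsScalarTower ℂ ℂ[G] M] [IsSimpleModule ℂ[G] M] :
    (Representation.ofModule' (k := ℂ) (G := G) M).IsIrreducible := by
  rw [Representation.irreducible_iff_isSimpleModule_asModule]
  let e : (Representation.ofModule' (k := ℂ) (G := G) M).asModule ≃ₗ[ℂ[G]] M :=
    { (Representation.ofModule' (k := ℂ) (G := G) M).asModuleEquiv with
      map_smul' := fun r x => by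
        change Representation.asModuleEquiv _ (r • x) = r • Representation.asModuleEquiv _ x
        rw [Representation.asModuleEquiv_map_smul, asAlgebraHom_ofModule', Algebra.lsmul_coe] }
  exact IsSimpleModule.congr e

/-- An element of the group algebra acting as zero in all irreducible representations vanishes. -/
theorem eq_zero_of_forall_irreducible {G : Type u} [Group G] [Fintype G] (φ : G → ℂ)
    (h : ∀ (V : Type u) [AddCommGroup V] [Module ℂ V] [FiniteDimensional ℂ V]
      (σ : Representation ℂ G V), σ.IsIrreducible → ∑ g, φ g • σ g = 0) : φ = 0 := by
  have : NeZero (Nat.card G : ℂ) := ⟨by simp⟩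
  set a : ℂ[G] := ∑ g, MonoidAlgebra.single g (φ g) with ha
  have hker : ∀ x : ℂ[G], a * x = 0 := by
    have hs := IsSemisimpleModule.sSup_simples_eq_top ℂ[G] ℂ[G]
    intro x
    have hx : x ∈ sSup {m : Submodule ℂ[G] ℂ[G] | IsSimpleModule ℂ[G] m} := hs ▸ trivial
    rw [sSup_eq_iSup'] at hx
    induction hx using Submodule.iSup_induction' with
    | mem m x hx =>
      have : IsSimpleModule ℂ[G] m := m.2
      have : FiniteDimensional ℂ m := Module.Finite.trans ℂ[G] _
      have h1 : (Representation.ofModule' (k := ℂ) (G := G) m).asAlgebraHom a = 0 := by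
        simpa [ha, Representation.asAlgebraHom_single] using h m _ (isIrreducible_ofModule' m)
      rw [asAlgebraHom_ofModule'] at h1
      exact congrArg Subtype.val (LinearMap.congr_fun h1 ⟨x, hx⟩)
    | zero => simp
    | add x y _ _ hx hy => rw [mul_add, hx, hy, add_zero]
  have h1 : a = 0 := by simpa using hker 1
  funext g
  classical
  have := congrArg (fun b : ℂ[G] => b.coeff g) h1
  simpa [ha, Finsupp.finsetSum_apply, Finsupp.single_apply] using this

/-- The regular character decomposes as the sum of the irreducible characters, each weighted by its
degree. -/
theorem sum_degree_mul_trace [Fintype G] [DecidableEq G] (g : G) :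
    ∑ c : Irrep G, (c.degree : ℂ) * (c.mat g).trace = if g = 1 then (Fintype.card G : ℂ) else 0 := by
  classical
  have hG : (Nat.card G : ℂ) ≠ 0 := by simp
  have : Invertible (Nat.card G : ℂ) := invertibleOfNonzero hG
  have htr (c : Irrep G) (g : G) :
      (c.mat g).trace = (toRepresentation c.rep.hom).character g :=
    (Matrix.trace_toLin'_eq (c.mat g)).symm
  set h : G → ℂ := fun g =>
    ∑ c : Irrep G, (c.degree : ℂ) * (c.mat g).trace - if g = 1 then (Fintype.card G : ℂ) else 0
  have horth (c' : Irrep G) : ∑ g, h g * (toRepresentation c'.rep.hom).character g⁻¹ = 0 := by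
    have := c'.rep.irreducible
    have key (c : Irrep G) : ∑ g, (c.mat g).trace * (toRepresentation c'.rep.hom).character g⁻¹
        = if c = c' then (Nat.card G : ℂ) else 0 := by
      have := c.rep.irreducible
      have h1 := Representation.char_orthonormal (toRepresentation c.rep.hom)
        (toRepresentation c'.rep.hom)
      have h2 : Nonempty ((toRepresentation c'.rep.hom).Equiv (toRepresentation c.rep.hom)) ↔
          c = c' := by
        constructor
        · intro h
          exact (Quotient.out_equiv_out.mp h).symm
        · rintro rfl
          exact ⟨.refl _⟩
      rw [inv_mul_eq_iff_eq_mul₀ hG] at h1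
      simp only [htr, h1, h2]
      split_ifs <;> simp
    have hone : (toRepresentation c'.rep.hom).character 1 = c'.degree := by
      rw [Representation.char_one]
      simp [Irrep.degree]
    simp only [h, sub_mul, Finset.sum_sub_distrib, Finset.sum_mul, ite_mul, zero_mul]
    rw [Finset.sum_comm]
    simp only [mul_assoc, ← Finset.mul_sum, key]
    simp [hone, mul_comm]
  have hzero : (fun g => h g⁻¹) = 0 := by
    apply eq_zero_of_forall_irreducible
    intro V _ _ _ σ hσ
    apply sum_smul_eq_zero_of_character
    · intro g k
      have (c : Irrep G) : (c.mat (k * g * k⁻¹)⁻¹).trace = (c.mat g⁻¹).trace := by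
        rw [htr, htr, mul_inv_rev, mul_inv_rev, inv_inv, ← mul_assoc, Representation.char_conj]
      simp only [h, this, inv_eq_one, conj_eq_one_iff]
    · obtain ⟨c, ⟨e⟩⟩ := exists_irrep_equiv σ
      rw [← horth c, Representation.char_iso e, ← Equiv.sum_comp (Equiv.inv G)]
      simp
  have := congrFun hzero g⁻¹
  simpa [h, sub_eq_zero] using this

end Completeness

section Fourier

variable {G : Type*} [Group G] [Fintype G]

open scoped Classical in
/-- The distribution of `Z_ℓ ⋯ Z_1` for independent `Z_i` with distribution `γ`. -/
noncomputable def convPow (γ : G → ℝ) : ℕ → G → ℝ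
  | 0, y => if y = 1 then 1 else 0
  | ℓ + 1, y => ∑ s, γ s * convPow γ ℓ (y * s⁻¹)

theorem sum_degree_mul_trace_fourierTransform_pow (γ : G → ℝ) (ℓ : ℕ) (x : G) :
    ∑ c : Irrep G, (c.degree : ℂ) * (fourierTransform γ c.mat ^ ℓ * c.mat x).trace =
      Fintype.card G * (convPow γ ℓ x⁻¹ : ℝ) := by
  classical
  induction ℓ generalizing x with
  | zero =>
    simp only [pow_zero, one_mul, sum_degree_mul_trace, convPow, inv_eq_one]
    split_ifs <;> simp
  | succ ℓ ih =>
    have h (c : Irrep G) : (fourierTransform γ c.mat ^ (ℓ + 1) * c.mat x).trace =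
        ∑ s, (γ s : ℂ) * (fourierTransform γ c.mat ^ ℓ * c.mat (s * x)).trace := by
      rw [pow_succ, mul_assoc]
      conv_lhs => enter [1, 2, 1]; rw [fourierTransform]
      simp [Finset.sum_mul, Finset.mul_sum, Matrix.trace_sum]
    simp only [h, Finset.mul_sum]
    rw [Finset.sum_comm]
    simp only [mul_left_comm _ (γ _ : ℂ), ← Finset.mul_sum, ih, convPow]
    push_cast
    rw [Finset.mul_sum]
    simp [mul_left_comm]

theorem tensorMatrix_mul {n : ℕ} {d : Fin n → ℕ} (A B : ∀ i, Matrix (Fin (d i)) (Fin (d i)) ℂ) :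
    tensorMatrix A * tensorMatrix B = tensorMatrix fun i => A i * B i := by
  ext a b
  simp only [tensorMatrix, Matrix.of_apply, Matrix.mul_apply]
  rw [Finset.prod_univ_sum]
  simp [Finset.prod_mul_distrib]

theorem trace_tensorMatrix {n : ℕ} {d : Fin n → ℕ} (A : ∀ i, Matrix (Fin (d i)) (Fin (d i)) ℂ) :
    (tensorMatrix A).trace = ∏ i, (A i).trace := by
  simp only [tensorMatrix, Matrix.trace, Matrix.diag_apply, Matrix.of_apply]
  rw [Finset.prod_univ_sum]
  simp

/-- Fourier inversion: `traceSum` is, up to a constant, the integral of `J(x⁻¹)` against a product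
of convolution powers. -/
theorem traceSum_eq {n : ℕ} (γ : G → ℝ) (ℓ : Fin n → ℕ) (J : (Fin n → G) → ℝ) :
    traceSum γ ℓ J =
      (Fintype.card G : ℂ) ^ n * (∑ y : Fin n → G, (∏ i, convPow γ (ℓ i) (y i)) * J y⁻¹ : ℝ) := by
  have h (ρ : Fin n → Irrep G) : (∏ i, ((ρ i).degree : ℂ)) *
      Matrix.trace (tensorMatrix (fun i => fourierTransform γ (ρ i).mat ^ ℓ i) *
        fourierTransform J (tensorRep ρ)) =
      ∑ x : Fin n → G, (J x : ℂ) * ∏ i, ((ρ i).degree : ℂ) *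
        (fourierTransform γ (ρ i).mat ^ ℓ i * (ρ i).mat (x i)).trace := by
    conv_lhs => enter [2, 1, 2]; rw [fourierTransform]
    simp only [Finset.mul_sum, Matrix.trace_sum, Matrix.mul_smul, Matrix.trace_smul, tensorRep,
      MonoidHom.coe_mk, OneHom.coe_mk, tensorMatrix_mul, trace_tensorMatrix, smul_eq_mul,
      Finset.prod_mul_distrib]
    exact Finset.sum_congr rfl fun x _ => mul_left_comm _ _ _
  rw [traceSum]
  simp only [h]
  rw [Finset.sum_comm]
  simp only [← Finset.mul_sum]
  rw [← Equiv.sum_comp (Equiv.inv (Fin n → G))]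
  push_cast
  rw [Finset.mul_sum]
  refine Finset.sum_congr rfl fun y _ => ?_
  have h2 := Finset.prod_univ_sum (fun _ : Fin n => (Finset.univ : Finset (Irrep G)))
    (fun i c => (c.degree : ℂ) * (fourierTransform γ c.mat ^ ℓ i * c.mat (y⁻¹ i)).trace)
  rw [Fintype.piFinset_univ] at h2
  simp only [Equiv.inv_apply]
  rw [← h2]
  simp only [sum_degree_mul_trace_fourierTransform_pow, Finset.prod_mul_distrib, Pi.inv_apply,
    inv_inv, Finset.prod_const, Finset.card_univ, Fintype.card_fin]
  ring

end Fourier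

section Correlations

variable {G : Type*} [Group G]

/-- The product of the values of `f` along the path from `k` with successive increments `y`. -/
def pathProd (f : G → ℝ) : (m : ℕ) → (Fin m → G) → G → ℝ
  | 0, _, k => f k
  | m + 1, y, k => f k * pathProd f m (Fin.tail y) (y 0 * k)

/-- The successive increments of a path `p`. -/
def increments {m : ℕ} (p : Fin (m + 1) → G) (i : Fin m) : G := p i.succ * (p i.castSucc)⁻¹

theorem pathProd_increments (f : G → ℝ) {m : ℕ} (p : Fin (m + 1) → G) (g : G) :
    pathProd f m (increments p) (p 0 * g) = ∏ i, f (p i * g) := by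
  induction m with
  | zero => simp [pathProd]
  | succ m ih =>
    rw [pathProd, Fin.prod_univ_succ]
    have h : increments p 0 * (p 0 * g) = Fin.tail p 0 * g := by
      simp [increments, Fin.tail, mul_assoc]
    rw [h]
    exact congrArg _ (ih (Fin.tail p))

variable [Fintype G]

/-- The multiple spatial autocorrelation of a scenery. -/
def autocorrelation (f : G → Fin 2) {m : ℕ} (y : Fin m → G) : ℝ :=
  ∑ k, pathProd (fun x => (f x : ℝ)) m y k

theorem autocorrelation_increments (f : G → Fin 2) {m : ℕ} (p : Fin (m + 1) → G) :
    autocorrelation f (increments p) = ∑ g, ∏ i, (f (p i * g) : ℝ) := by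
  rw [autocorrelation, ← Equiv.sum_comp (Equiv.mulLeft (p 0))]
  exact Finset.sum_congr rfl fun g _ => pathProd_increments _ p g

theorem exists_support_shift_subset {f₁ f₂ : G → Fin 2}
    (h : ∀ y : Fin (Fintype.card G) → G, autocorrelation f₁ y = autocorrelation f₂ y) :
    ∃ g : G, ∀ k, f₁ k = 1 → f₂ (k * g) = 1 := by
  by_cases hs : ∃ s, f₁ s = 1
  · obtain ⟨s, hs⟩ := hs
    let p : Fin (Fintype.card G + 1) → G := Fin.cons s fun i =>
      if f₁ ((Fintype.equivFin G).symm i) = 1 then (Fintype.equivFin G).symm i else s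
    have hp : ∀ i, f₁ (p i) = 1 := by
      refine Fin.cases hs fun i => ?_
      simp only [p, Fin.cons_succ]
      split_ifs with hi
      exacts [hi, hs]
    have hcover : ∀ k, f₁ k = 1 → ∃ i, p i = k := fun k hk =>
      ⟨(Fintype.equivFin G k).succ, by simp [p, hk]⟩
    have hpos : 0 < autocorrelation f₂ (increments p) := by
      rw [← h, autocorrelation_increments]
      refine Finset.sum_pos' (fun g _ => Finset.prod_nonneg fun i _ => Nat.cast_nonneg _)
        ⟨1, Finset.mem_univ _, ?_⟩
      simp [hp]
    rw [autocorrelation_increments] at hpos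
    obtain ⟨g, -, hg⟩ := Finset.exists_ne_zero_of_sum_ne_zero hpos.ne'
    refine ⟨g, fun k hk => ?_⟩
    obtain ⟨i, rfl⟩ := hcover k hk
    have := Finset.prod_ne_zero_iff.mp hg i (Finset.mem_univ i)
    generalize f₂ (p i * g) = b at this ⊢
    fin_cases b <;> simp_all
  · exact ⟨1, fun k hk => (hs ⟨k, hk⟩).elim⟩

/-- The autocorrelations with `|G|` increments determine a scenery up to a shift. -/
theorem exists_shift_of_autocorrelation_eq {f₁ f₂ : G → Fin 2}
    (h : ∀ y : Fin (Fintype.card G) → G, autocorrelation f₁ y = autocorrelation f₂ y) :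
    ∃ g : G, ∀ k, f₁ k = f₂ (k * g) := by
  classical
  obtain ⟨g, hg⟩ := exists_support_shift_subset h
  obtain ⟨g', hg'⟩ := exists_support_shift_subset fun y => (h y).symm
  refine ⟨g, ?_⟩
  let S (f : G → Fin 2) : Finset G := {k | f k = 1}
  have h12 : (S f₁).map (Equiv.mulRight g).toEmbedding ⊆ S f₂ := by
    intro k hk
    obtain ⟨k, hk, rfl⟩ := Finset.mem_map.mp hk
    simpa [S] using hg k (by simpa [S] using hk)
  have h21 : (S f₂).map (Equiv.mulRight g').toEmbedding ⊆ S f₁ := by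
    intro k hk
    obtain ⟨k, hk, rfl⟩ := Finset.mem_map.mp hk
    simpa [S] using hg' k (by simpa [S] using hk)
  have hcard := Finset.card_le_card h21
  have heq := Finset.eq_of_subset_of_card_le h12 (by simpa using hcard)
  intro k
  have hiff : f₁ k = 1 ↔ f₂ (k * g) = 1 := by
    refine ⟨hg k, fun hk => ?_⟩
    have : k * g ∈ (S f₁).map (Equiv.mulRight g).toEmbedding := by
      rw [heq]
      simpa [S] using hk
    obtain ⟨k', hk', he⟩ := Finset.mem_map.mp this
    rw [← mul_right_cancel (b := g) (show k' * g = k * g from he)]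
    simpa [S] using hk'
  omega

/-- The transition operator of the walk. -/
def transition (γ : G → ℝ) (h : G → ℝ) (x : G) : ℝ := ∑ s, γ s * h (s * x)

theorem transition_iterate (γ : G → ℝ) (h : G → ℝ) (ℓ : ℕ) (x : G) :
    (transition γ)^[ℓ] h x = ∑ y, convPow γ ℓ y * h (y * x) := by
  classical
  induction ℓ generalizing x with
  | zero => simp [convPow]
  | succ ℓ ih =>
    rw [Function.iterate_succ_apply', transition]
    simp only [ih, convPow, Finset.sum_mul, Finset.mul_sum]
    conv_rhs => rw [Finset.sum_comm]
    refine Finset.sum_congr rfl fun s _ => ?_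
    conv_rhs => rw [← Equiv.sum_comp (Equiv.mulRight s)]
    simp [mul_assoc]

/-- The conditional expectation, given that the walk is at `k`, of the product of the values of `f`
at the current time and after each of the successive time lags `ℓ`. -/
def lagExpectation (γ : G → ℝ) (f : G → ℝ) : (m : ℕ) → (Fin m → ℕ) → G → ℝ
  | 0, _, k => f k
  | m + 1, ℓ, k => f k * (transition γ)^[ℓ 0] (lagExpectation γ f m (Fin.tail ℓ)) k

theorem lagExpectation_eq (γ : G → ℝ) (f : G → ℝ) {m : ℕ} (ℓ : Fin m → ℕ) (k : G) :
    lagExpectation γ f m ℓ k = ∑ y : Fin m → G, (∏ i, convPow γ (ℓ i) (y i)) * pathProd f m y k := by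
  induction m generalizing k with
  | zero => simp [lagExpectation, pathProd]
  | succ m ih =>
    rw [lagExpectation, transition_iterate, ← (Fin.consEquiv fun _ => G).sum_comp,
      Fintype.sum_prod_type, Finset.mul_sum]
    refine Finset.sum_congr rfl fun y _ => ?_
    rw [ih, Finset.mul_sum, Finset.mul_sum]
    refine Finset.sum_congr rfl fun z _ => ?_
    simp only [Fin.consEquiv, Equiv.coe_fn_mk, Fin.prod_univ_succ, Fin.cons_zero, Fin.cons_succ,
      pathProd, Fin.tail_cons]
    simp only [Fin.tail]
    ring

end Correlations

section Probability

variable {G Ω : Type*}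

theorem integral_comp_fintype [MeasurableSpace Ω] {μ : Measure Ω} [IsProbabilityMeasure μ]
    {A : Type*} [Fintype A] [MeasurableSpace A]
    [MeasurableSingletonClass A] {X : Ω → A} (hX : Measurable X) (K : A → ℝ) :
    ∫ ω, K (X ω) ∂μ = ∑ a, μ.real (X ⁻¹' {a}) * K a := by
  have : IsProbabilityMeasure (μ.map X) := Measure.isProbabilityMeasure_map hX.aemeasurable
  rw [← integral_map hX.aemeasurable (Measurable.of_discrete (f := K)).aestronglyMeasurable,
    integral_fintype (Integrable.of_finite)]
  simp [map_measureReal_apply hX]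

/-- Integrating out a variable independent of the past. -/
theorem integral_prod_eq_of_real_inter [Fintype G] [MeasurableSpace G] [MeasurableSingletonClass G]
    [MeasurableSpace Ω] {μ : Measure Ω} [IsProbabilityMeasure μ] {A : Type*} [Fintype A]
    [MeasurableSpace A] [MeasurableSingletonClass A] {X : Ω → A} {Y : Ω → G} {γ : G → ℝ} (hX : Measurable X)
    (hY : Measurable Y)
    (h : ∀ a s, μ.real (X ⁻¹' {a} ∩ Y ⁻¹' {s}) = μ.real (X ⁻¹' {a}) * γ s) (K : A → G → ℝ) :
    ∫ ω, K (X ω) (Y ω) ∂μ = ∫ ω, ∑ s, γ s * K (X ω) s ∂μ := by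
  rw [integral_comp_fintype hX fun a => ∑ s, γ s * K a s,
    integral_comp_fintype (hX.prodMk hY) fun p => K p.1 p.2, Fintype.sum_prod_type]
  refine Finset.sum_congr rfl fun a _ => ?_
  rw [Finset.mul_sum]
  refine Finset.sum_congr rfl fun s _ => ?_
  rw [← mul_assoc, ← h, ← Set.singleton_prod_singleton, Set.mk_preimage_prod]

/-- The initial position together with the first `t` increments. -/
def history (v₀ : Ω → G) (Z : ℕ → Ω → G) (t : ℕ) (ω : Ω) : G × (Finset.range t → G) :=
  (v₀ ω, fun i => Z i ω)

variable {v₀ : Ω → G} {Z : ℕ → Ω → G}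

theorem measurable_history [MeasurableSpace G] [MeasurableSpace Ω]
    (hv : Measurable v₀) (hZ : ∀ t, Measurable (Z t)) (t : ℕ) :
    Measurable (history v₀ Z t) :=
  hv.prodMk (measurable_pi_lambda _ fun i => hZ i)

theorem real_history_inter [MeasurableSpace G] [MeasurableSingletonClass G]
    [MeasurableSpace Ω] {μ : Measure Ω} {γ : G → ℝ} (hZ : ∀ t, Measurable (Z t)) (hi : iIndepFun Z μ)
    (h0 : IndepFun v₀ (fun ω t => Z t ω) μ) (hγ : ∀ t s, μ.real (Z t ⁻¹' {s}) = γ s) (t : ℕ)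
    (a : G × (Finset.range t → G)) (s : G) :
    μ.real (history v₀ Z t ⁻¹' {a} ∩ Z t ⁻¹' {s}) = μ.real (history v₀ Z t ⁻¹' {a}) * γ s := by
  obtain ⟨a, z⟩ := a
  let R : (ℕ → G) → (Finset.range t → G) := fun w i => w i
  have hR : Measurable R := measurable_pi_lambda _ fun i => measurable_pi_apply _
  have e1 : history v₀ Z t ⁻¹' {(a, z)} =
      v₀ ⁻¹' {a} ∩ (fun ω t => Z t ω) ⁻¹' (R ⁻¹' {z}) := by
    ext ω
    simp [history, R]
  have e2 : history v₀ Z t ⁻¹' {(a, z)} ∩ Z t ⁻¹' {s} =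
      v₀ ⁻¹' {a} ∩ (fun ω t => Z t ω) ⁻¹' (R ⁻¹' {z} ∩ (fun w => w t) ⁻¹' {s}) := by
    rw [e1, Set.inter_assoc]
    rfl
  have e3 : μ.real ((fun ω t => Z t ω) ⁻¹' (R ⁻¹' {z} ∩ (fun w => w t) ⁻¹' {s})) =
      μ.real ((fun ω t => Z t ω) ⁻¹' (R ⁻¹' {z})) * γ s := by
    have hd : IndepFun (fun ω (i : Finset.range t) => Z i ω) (fun ω (i : ({t} : Finset ℕ)) => Z i ω)
        μ := hi.indepFun_finset _ _ (by simp) hZ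
    have := (hd.comp measurable_id (measurable_pi_apply
      (⟨t, Finset.mem_singleton_self t⟩ : ({t} : Finset ℕ)))).measure_inter_preimage_eq_mul {z} {s}
      (measurableSet_singleton _) (measurableSet_singleton _)
    rw [← hγ t s, measureReal_def, measureReal_def, measureReal_def, ← ENNReal.toReal_mul]
    exact congrArg _ this
  rw [e2, e1]
  have hm1 := h0.measure_inter_preimage_eq_mul {a} (R ⁻¹' {z}) (measurableSet_singleton _)
    (hR (measurableSet_singleton _))
  have hm2 := h0.measure_inter_preimage_eq_mul {a} (R ⁻¹' {z} ∩ (fun w => w t) ⁻¹' {s})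
    (measurableSet_singleton _)
    ((hR (measurableSet_singleton _)).inter (measurable_pi_apply t (measurableSet_singleton _)))
  rw [measureReal_def, hm2, measureReal_def, hm1, ENNReal.toReal_mul, ENNReal.toReal_mul, mul_assoc]
  exact congrArg _ e3

theorem factorsThrough_history_mono {B : Type*} {F : Ω → B} {s t : ℕ} (hst : s ≤ t)
    (hF : F.FactorsThrough (history v₀ Z s)) : F.FactorsThrough (history v₀ Z t) := by
  intro ω ω' h
  apply hF
  simp only [history, Prod.mk.injEq, funext_iff, Subtype.forall, Finset.mem_range] at h ⊢
  exact ⟨h.1, fun i hi => h.2 i (hi.trans_le hst)⟩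

theorem walk_factorsThrough_history [Group G] {v : ℕ → Ω → G}
    (hv : ∀ t ω, v (t + 1) ω = Z t ω * v t ω) (t : ℕ) : (v t).FactorsThrough (history (v 0) Z t) := by
  induction t with
  | zero =>
    intro ω ω' h
    exact congrArg Prod.fst h
  | succ t ih =>
    intro ω ω' h
    rw [hv, hv, factorsThrough_history_mono t.le_succ ih h]
    have := congrFun (congrArg Prod.snd h) ⟨t, by simp⟩
    exact congrArg (· * v t ω') this

variable [Group G] [Fintype G] [MeasurableSpace G] [MeasurableSingletonClass G]
  [MeasurableSpace Ω] {μ : Measure Ω} [IsProbabilityMeasure μ]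

/-- The Markov property of the walk, over one step. -/
theorem integral_mul_walk_succ {γ : G → ℝ} {v : ℕ → Ω → G} (hv0 : Measurable (v 0))
    (hZ : ∀ t, Measurable (Z t)) (hi : iIndepFun Z μ)
    (h0 : IndepFun (v 0) (fun ω t => Z t ω) μ) (hγ : ∀ t s, μ.real (Z t ⁻¹' {s}) = γ s)
    (hv : ∀ t ω, v (t + 1) ω = Z t ω * v t ω) (h : G → ℝ) {t : ℕ} {F : Ω → ℝ}
    (hF : F.FactorsThrough (history (v 0) Z t)) :
    ∫ ω, F ω * h (v (t + 1) ω) ∂μ = ∫ ω, F ω * transition γ h (v t ω) ∂μ := by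
  obtain ⟨F', rfl⟩ := (Function.factorsThrough_iff _).mp hF
  obtain ⟨v', hv'⟩ := (Function.factorsThrough_iff _).mp (walk_factorsThrough_history hv t)
  have := integral_prod_eq_of_real_inter (measurable_history hv0 hZ t) (hZ t)
    (real_history_inter hZ hi h0 hγ t) fun a s => F' a * h (s * v' a)
  simp only [hv, hv', Function.comp_apply, transition, Finset.mul_sum]
  rw [this]
  simp only [mul_left_comm]

theorem integral_mul_walk_add {γ : G → ℝ} {v : ℕ → Ω → G} (hv0 : Measurable (v 0))
    (hZ : ∀ t, Measurable (Z t)) (hi : iIndepFun Z μ)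
    (h0 : IndepFun (v 0) (fun ω t => Z t ω) μ) (hγ : ∀ t s, μ.real (Z t ⁻¹' {s}) = γ s)
    (hv : ∀ t ω, v (t + 1) ω = Z t ω * v t ω) (h : G → ℝ) {t : ℕ} {F : Ω → ℝ}
    (hF : F.FactorsThrough (history (v 0) Z t)) (ℓ : ℕ) :
    ∫ ω, F ω * h (v (t + ℓ) ω) ∂μ = ∫ ω, F ω * (transition γ)^[ℓ] h (v t ω) ∂μ := by
  induction ℓ generalizing h with
  | zero => rfl
  | succ ℓ ih =>
    rw [Function.iterate_succ_apply, ← ih, ← add_assoc]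
    exact integral_mul_walk_succ hv0 hZ hi h0 hγ hv h
      (factorsThrough_history_mono (t.le_add_right ℓ) hF)

/-- The product of the terms of a sequence at time `t` and after each of the successive lags `ℓ`. -/
def lagProd : (m : ℕ) → (Fin m → ℕ) → ℕ → (ℕ → Fin 2) → ℝ
  | 0, _, t, a => (a t : ℝ)
  | m + 1, ℓ, t, a => (a t : ℝ) * lagProd m (Fin.tail ℓ) (t + ℓ 0) a

theorem measurable_lagProd {m : ℕ} (ℓ : Fin m → ℕ) (t : ℕ) : Measurable (lagProd m ℓ t) := by
  have h (t : ℕ) : Measurable fun a : ℕ → Fin 2 => (a t : ℝ) :=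
    (Measurable.of_discrete (f := fun b : Fin 2 => (b : ℝ))).comp (measurable_pi_apply t)
  induction m generalizing t with
  | zero => exact h t
  | succ m ih => exact (h t).mul (ih _ _)

theorem integral_mul_lagProd {γ : G → ℝ} {v : ℕ → Ω → G} (hv0 : Measurable (v 0))
    (hZ : ∀ t, Measurable (Z t)) (hi : iIndepFun Z μ)
    (h0 : IndepFun (v 0) (fun ω t => Z t ω) μ) (hγ : ∀ t s, μ.real (Z t ⁻¹' {s}) = γ s)
    (hv : ∀ t ω, v (t + 1) ω = Z t ω * v t ω) (f : G → Fin 2) {m : ℕ} (ℓ : Fin m → ℕ) {t : ℕ}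
    {F : Ω → ℝ} (hF : F.FactorsThrough (history (v 0) Z t)) :
    ∫ ω, F ω * lagProd m ℓ t (fun t => f (v t ω)) ∂μ =
      ∫ ω, F ω * lagExpectation γ (fun x => (f x : ℝ)) m ℓ (v t ω) ∂μ := by
  induction m generalizing t F with
  | zero => rfl
  | succ m ih =>
    have hF' : (fun ω => F ω * (f (v t ω) : ℝ)).FactorsThrough (history (v 0) Z t) := by
      intro ω ω' h
      simp only [hF h, walk_factorsThrough_history hv t h]
    simp only [lagProd, lagExpectation, ← mul_assoc]
    rw [ih _ (factorsThrough_history_mono (t.le_add_right _) hF'),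
      integral_mul_walk_add hv0 hZ hi h0 hγ hv _ hF']

/-- The observed law determines the autocorrelations smoothed by the step distribution. -/
theorem integral_lagProd_observedLaw {γ : G → ℝ} {v : ℕ → Ω → G} (hwalk : IsRandomWalk μ γ v)
    (hstart : UniformStart μ v) (f : G → Fin 2) {m : ℕ} (ℓ : Fin m → ℕ) :
    ∫ a, lagProd m ℓ 0 a ∂(observedLaw μ v f) = (Nat.card G : ℝ)⁻¹ *
      ∑ y : Fin m → G, (∏ i, convPow γ (ℓ i) (y i)) * autocorrelation f y := by
  obtain ⟨hv0, Z, hZ, hi, h0, hγ, hv⟩ := hwalk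
  have hmeas : ∀ t, Measurable (v t) := by
    intro t
    obtain ⟨v', hv'⟩ := (Function.factorsThrough_iff _).mp (walk_factorsThrough_history hv t)
    rw [hv']
    exact Measurable.of_discrete.comp (measurable_history hv0 hZ t)
  have hobs : Measurable fun ω t => f (v t ω) :=
    measurable_pi_lambda _ fun t => Measurable.of_discrete.comp (hmeas t)
  rw [observedLaw, integral_map hobs.aemeasurable (measurable_lagProd ℓ 0).aestronglyMeasurable]
  have := integral_mul_lagProd hv0 hZ hi h0 hγ hv f ℓ (t := 0) (F := fun _ => 1)
    (fun _ _ _ => rfl)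
  simp only [one_mul] at this
  rw [this, integral_comp_fintype hv0]
  simp only [hstart _, ← Finset.mul_sum, lagExpectation_eq, autocorrelation]
  rw [Finset.sum_comm]
  simp only [← Finset.mul_sum]

end Probability

end SceneryReconstruction

theorem theorem1 {G : Type*} [Group G] [Fintype G] [MeasurableSpace G] [MeasurableSingletonClass G]
    {Ω : Type*} [MeasurableSpace Ω] (μ : MeasureTheory.Measure Ω)
    [MeasureTheory.IsProbabilityMeasure μ] (γ : G → ℝ) (v : ℕ → Ω → G)
    (hwalk : SceneryReconstruction.IsRandomWalk μ γ v)
    (hstart : SceneryReconstruction.UniformStart μ v)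
    (hγ : SceneryReconstruction.FourierCondition γ) :
    SceneryReconstruction.Reconstructive μ v := by
  intro f₁ f₂ hobs
  apply SceneryReconstruction.exists_shift_of_autocorrelation_eq
  have hJ := hγ (fun x => SceneryReconstruction.autocorrelation f₁ x⁻¹ -
      SceneryReconstruction.autocorrelation f₂ x⁻¹) fun ℓ _ => by
    have h₁ := SceneryReconstruction.integral_lagProd_observedLaw hwalk hstart f₁ ℓ
    rw [hobs, SceneryReconstruction.integral_lagProd_observedLaw hwalk hstart f₂ ℓ] at h₁
    have h₂ := mul_left_cancel₀ (by simp) h₁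
    simp only [SceneryReconstruction.traceSum_eq, inv_inv, mul_sub, Finset.sum_sub_distrib,
      h₂, sub_self, Complex.ofReal_zero, mul_zero]
  intro y
  simpa [sub_eq_zero] using hJ y⁻¹
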